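/- Let $m\ge 1$ and $N\ge 2$ be integers. For a probability vector $p=(p_1,\dots,p_N)$ with all $p_i>0$ and $\sum_i p_i=1$, let coupons be drawn independently, each draw being of type $i$ with probability $p_i$, and let $T_m(N)$ be the number of draws needed until at least $m$ copies of each of the $N$ coupon types have been collected. Write $\operatorname{Var}_p(T_m(N))$ for its variance, and let $u=(1/N,\dots,1/N)$. Then for every such $p$ the time $T_m(N)$ is almost surely finite and square integrable, and $$\operatorname{Var}_p(T_m(N))\ \ge\ \operatorname{Var}_u(T_m(N)),$$ with equality if and only if $p=u$. Moreover, if $p\ne u$ and $p(\theta)=u+\theta(p-u)$, then $\theta\mapsto \operatorname{Var}_{p(\theta)}(T_m(N))$ is strictly increasing on the set of all $\theta\ge 0$ for which every coordinate of $p(\theta)$ is positive (in particular on $[0,1]$). -/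

import Mathlib

open MeasureTheory ProbabilityTheory

namespace DixieCup

/-- The law of one draw: coupon type `j` has probability `p j`. -/
noncomputable def drawLaw {N : ℕ} (p : Fin N → ℝ) : Measure (Fin N) :=
  ∑ j, ENNReal.ofReal (p j) • Measure.dirac j

/-- The law of an infinite sequence of independent draws `ω 0, ω 1, …`, each with law `drawLaw p`. -/
noncomputable def drawsLaw {N : ℕ} (p : Fin N → ℝ) : Measure (ℕ → Fin N) :=
  Measure.infinitePi fun _ : ℕ => drawLaw p

/-- The number of copies of coupon type `j` among the first `n` draws. -/
def copies {N : ℕ} (ω : ℕ → Fin N) (n : ℕ) (j : Fin N) : ℕ :=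
  ((Finset.range n).filter fun k => ω k = j).card

/-- The number of draws needed to collect at least `m` copies of each of the `N` coupon types
(`⊤` if this never happens). -/
noncomputable def completionTime (m : ℕ) {N : ℕ} (ω : ℕ → Fin N) : ℕ∞ :=
  ⨅ (n : ℕ) (_ : ∀ j, m ≤ copies ω n j), (n : ℕ∞)

/-- The completion time as a real random variable. The value `0` is assigned to the draw sequences
whose completion time is infinite. -/
noncomputable def realTime (m : ℕ) {N : ℕ} (ω : ℕ → Fin N) : ℝ :=
  ((completionTime m ω).toNat : ℝ)

/-- The variance of the completion time when the coupon probabilities are `p`. -/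
noncomputable def timeVariance (m : ℕ) {N : ℕ} (p : Fin N → ℝ) : ℝ :=
  Var[realTime m; drawsLaw p]

/-- The uniform probability vector `(1/N, …, 1/N)`. -/
noncomputable def uniformVec (N : ℕ) : Fin N → ℝ := fun _ => 1 / (N : ℝ)

/-- The ray `θ ↦ u + θ (p - u)` from the uniform vector `u` through `p`. -/
noncomputable def ray {N : ℕ} (p : Fin N → ℝ) (θ : ℝ) : Fin N → ℝ :=
  uniformVec N + θ • (p - uniformVec N)

end DixieCup

namespace DixieCup

open Finset Filter Topology
open scoped Nat ENNReal

/-! ### The number of draws needed and its counting events -/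

/-! The proof passes to continuous time. If draws occur at the points of a rate one Poisson process,
the types are collected independently, so the completion time X is a maximum of independent Erlang
times with distribution function F = `maxCDF k p`, m = k + 1. Integrating the Poisson mixture
termwise gives E T = E X and E T(T+1) = E X², hence Var T = E X² - E X - (E X)² (`timeVariance_eq`).

Let S_q = `maxSlope k p q` be the derivative of F at t • p in direction q, without the factor t.
Then S_p is the density of X. For q = u - p, the derivative of Var T in direction q is minus 2 ∫ t²
S_q - (1 + 2 E X) ∫ t S_q, so this expression must be positive when p ≠ u
(`derivative_timeVariance_pos`). With h the reversed hazard rate of the Erlang law, S_q = F · ∑ q_j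
h(p_j t), and three facts suffice. (1) h is strictly decreasing and u - p sums to zero, so S_{u-p} >
0 (`maxSlope_uniformVec_sub_pos`). (2) h(as) h(bt) ≤ h(at) h(bs) for a ≤ b, s ≤ t, so S_u / S_p is
nondecreasing in t. Chebyshev's inequality for the weight t S_p then gives ∫ t² S_{u-p} ≥ c ∫ t
S_{u-p} with c = E X² / E X (`mul_integral_maxSlope_le`). (3) Var T ≥ 0 itself gives c ≥ 1 + E X, so
2c > 1 + 2 E X. -/

/-- The event that the first `n` draws contain at least `k j` copies of each type `j`. -/
def collected {N : ℕ} (k : Fin N → ℕ) (n : ℕ) : Set (ℕ → Fin N) :=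
  {ω | ∀ j, k j ≤ copies ω n j}

lemma copies_succ {N : ℕ} (ω : ℕ → Fin N) (n : ℕ) (j : Fin N) :
    copies ω (n + 1) j = copies ω n j + if ω n = j then 1 else 0 := by
  simp only [copies, card_filter, sum_range_succ]

lemma copies_mono {N : ℕ} (ω : ℕ → Fin N) (j : Fin N) : Monotone fun n => copies ω n j :=
  monotone_nat_of_le_succ fun n => by rw [copies_succ]; omega

lemma collected_mono {N : ℕ} (k : Fin N → ℕ) : Monotone (collected k) :=
  fun _ _ h _ hω j => (hω j).trans (copies_mono _ j h)

lemma completionTime_le_iff {N : ℕ} (m : ℕ) (ω : ℕ → Fin N) (n : ℕ) :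
    completionTime m ω ≤ n ↔ ω ∈ collected (fun _ => m) n := by
  constructor
  · intro h
    -- A strict bound on the infimum produces an actual witness below `n + 1`.
    have h1 : completionTime m ω < ((n + 1 : ℕ) : ℕ∞) :=
      h.trans_lt (by exact_mod_cast Nat.lt_succ_self n)
    simp only [completionTime, iInf_lt_iff] at h1
    obtain ⟨k, hk, hkn⟩ := h1
    exact collected_mono (fun _ => m) (Nat.lt_succ_iff.1 (by exact_mod_cast hkn)) hk
  · intro h
    exact iInf₂_le n h

lemma measurable_copies {N : ℕ} (n : ℕ) (j : Fin N) :
    Measurable fun ω : ℕ → Fin N => copies ω n j := by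
  simp only [copies, card_filter]
  exact Finset.measurable_sum _ fun i _ =>
    Measurable.ite (measurableSet_eq_fun (measurable_pi_apply i) measurable_const)
      measurable_const measurable_const

lemma measurableSet_collected {N : ℕ} (k : Fin N → ℕ) (n : ℕ) :
    MeasurableSet (collected k n) := by
  simp only [collected, Set.ofPred_forall]
  exact MeasurableSet.iInter fun j => measurable_copies n j measurableSet_Ici

lemma completionTime_eq_top_iff {N : ℕ} (m : ℕ) (ω : ℕ → Fin N) :
    completionTime m ω = ⊤ ↔ ∀ n, ω ∉ collected (fun _ => m) n := by
  simp only [← completionTime_le_iff]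
  constructor
  · intro h n
    simp [h]
  · intro h
    by_contra h'
    obtain ⟨n, hn⟩ := ENat.ne_top_iff_exists.1 h'
    exact h n hn.ge

lemma measurableSet_completionTime_eq_top {N : ℕ} (m : ℕ) :
    MeasurableSet {ω : ℕ → Fin N | completionTime m ω = ⊤} := by
  simp only [completionTime_eq_top_iff, Set.ofPred_forall]
  exact MeasurableSet.iInter fun n => (measurableSet_collected _ n).compl

lemma measurable_toNat_completionTime {N : ℕ} (m : ℕ) :
    Measurable fun ω : ℕ → Fin N => (completionTime m ω).toNat := by
  refine measurable_of_Iic fun n => ?_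
  -- `toNat` sends `⊤` to `0`, so the event of never finishing lies in every such preimage.
  have : (fun ω : ℕ → Fin N => (completionTime m ω).toNat) ⁻¹' Set.Iic n =
      {ω | completionTime m ω = ⊤} ∪ collected (fun _ => m) n := by
    ext ω
    rw [Set.mem_union, ← completionTime_le_iff]
    by_cases h : completionTime m ω = ⊤
    · simp [h]
    · obtain ⟨l, hl⟩ := ENat.ne_top_iff_exists.1 h
      simp [← hl]
  rw [this]
  exact (measurableSet_completionTime_eq_top m).union (measurableSet_collected _ n)

lemma isProbabilityMeasure_drawLaw {N : ℕ} {p : Fin N → ℝ} (hp : ∀ i, 0 ≤ p i)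
    (hs : ∑ i, p i = 1) : IsProbabilityMeasure (drawLaw p) := by
  constructor
  simp only [drawLaw, Measure.coe_finsetSum, Finset.sum_apply, Measure.smul_apply, measure_univ,
    smul_eq_mul, mul_one]
  rw [← ENNReal.ofReal_sum_of_nonneg fun i _ => hp i, hs, ENNReal.ofReal_one]

lemma drawLaw_real_singleton {N : ℕ} {p : Fin N → ℝ} (hp : ∀ i, 0 ≤ p i) (i : Fin N) :
    (drawLaw p).real {i} = p i := by
  simp [Measure.real, drawLaw, Measure.coe_finsetSum, Finset.sum_apply, Set.indicator_apply,
    ENNReal.toReal_ofReal (hp i)]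

lemma isProbabilityMeasure_drawsLaw {N : ℕ} {p : Fin N → ℝ} (hp : ∀ i, 0 ≤ p i)
    (hs : ∑ i, p i = 1) : IsProbabilityMeasure (drawsLaw p) := by
  have := isProbabilityMeasure_drawLaw hp hs
  unfold drawsLaw
  infer_instance

/-- What has been collected in the first `n` draws is independent of draw number `n`. -/
lemma drawsLaw_real_collected_inter {N : ℕ} {p : Fin N → ℝ} (hp : ∀ i, 0 ≤ p i)
    (hs : ∑ i, p i = 1) (k : Fin N → ℕ) (n : ℕ) (i : Fin N) :
    (drawsLaw p).real (collected k n ∩ {ω | ω n = i}) =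
      (drawsLaw p).real (collected k n) * p i := by
  have := isProbabilityMeasure_drawLaw hp hs
  have hind : iIndepFun (fun (l : ℕ) (ω : ℕ → Fin N) => ω l) (drawsLaw p) :=
    iIndepFun_infinitePi (P := fun _ : ℕ => drawLaw p) (X := fun _ x => x) fun _ => measurable_id
  have h2 := hind.indepFun_finset (range n) {n} (by simp) fun l => measurable_pi_apply l
  have h3 := h2.measure_inter_preimage_eq_mul
    {x | ∀ j, k j ≤ ((univ : Finset (range n)).filter fun l => x l = j).card}
    {x | x ⟨n, mem_singleton_self n⟩ = i} (Set.toFinite _).measurableSet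
    (Set.toFinite _).measurableSet
  have hA : (fun (a : ℕ → Fin N) (l : range n) => a l) ⁻¹'
      {x | ∀ j, k j ≤ ((univ : Finset (range n)).filter fun l => x l = j).card} =
        collected k n := by
    ext ω
    simp only [Set.mem_preimage, Set.mem_ofPred_eq, collected, copies, card_filter]
    refine forall_congr' fun j => ?_
    rw [← Finset.sum_coe_sort (range n)]
  have hB : (fun (a : ℕ → Fin N) (l : ({n} : Finset ℕ)) => a l) ⁻¹'
      {x | x ⟨n, mem_singleton_self n⟩ = i} = {ω | ω n = i} := rfl
  rw [hA, hB] at h3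
  have h4 : (drawsLaw p).real {ω | ω n = i} = p i := by
    rw [← drawLaw_real_singleton hp i, measureReal_def, measureReal_def]
    congr 1
    exact (measurePreserving_eval_infinitePi (fun _ : ℕ => drawLaw p) n).measure_preimage
      (measurableSet_singleton i).nullMeasurableSet
  rw [measureReal_def, h3, ENNReal.toReal_mul, ← measureReal_def, ← measureReal_def, h4]

lemma drawsLaw_real_collected_zero {N : ℕ} {p : Fin N → ℝ} (hp : ∀ i, 0 ≤ p i)
    (hs : ∑ i, p i = 1) (k : Fin N → ℕ) :
    (drawsLaw p).real (collected k 0) = if ∀ j, k j = 0 then 1 else 0 := by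
  have := isProbabilityMeasure_drawsLaw hp hs
  split_ifs with h
  · have : collected k 0 = Set.univ := by ext; simp [collected, h]
    rw [this, probReal_univ]
  · have : collected k 0 = ∅ := by
      ext ω
      simpa [collected, copies] using h
    rw [this, measureReal_empty]

/-- Conditioning on the last draw. -/
lemma drawsLaw_real_collected_succ {N : ℕ} {p : Fin N → ℝ} (hp : ∀ i, 0 ≤ p i)
    (hs : ∑ i, p i = 1) (k : Fin N → ℕ) (n : ℕ) :
    (drawsLaw p).real (collected k (n + 1)) =
      ∑ i, p i * (drawsLaw p).real (collected (k - Pi.single i 1) n) := by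
  have := isProbabilityMeasure_drawsLaw hp hs
  -- A last draw of type `i` lowers the demand for `i` by one; truncated subtraction is right when
  -- that demand is already zero.
  have hset : ∀ i, collected k (n + 1) ∩ {ω | ω n = i} =
      collected (k - Pi.single i 1) n ∩ {ω | ω n = i} := by
    intro i
    ext ω
    simp only [Set.mem_inter_iff, Set.mem_ofPred_eq, collected]
    refine and_congr_left fun hi => forall_congr' fun j => ?_
    rw [copies_succ, hi]
    by_cases hij : i = j
    · subst hij; simp
    · simp [hij, Ne.symm hij]
  have hU : collected k (n + 1) = ⋃ i ∈ (univ : Finset (Fin N)),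
      (collected k (n + 1) ∩ {ω | ω n = i}) := by
    ext ω; simp
  rw [hU, measureReal_biUnion_finset]
  · refine sum_congr rfl fun i _ => ?_
    rw [hset, drawsLaw_real_collected_inter hp hs, mul_comm]
  · intro i _ j _ hij
    refine Set.disjoint_left.2 fun ω h1 h2 => hij ?_
    exact h1.2.symm.trans h2.2
  · intro i _
    exact (measurableSet_collected _ _).inter
      (measurableSet_eq_fun (measurable_pi_apply n) measurable_const)

/-! ### The exponential generating function of the collection probabilities -/

/-- The exponential series without its first `k` terms. -/
noncomputable def cexpTail (k : ℕ) (z : ℂ) : ℂ := Complex.exp z - ∑ i ∈ range k, z ^ i / i !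

lemma cexpTail_zero_right (k : ℕ) : cexpTail k 0 = if k = 0 then 1 else 0 := by
  cases k with
  | zero => simp [cexpTail]
  | succ k => simp [cexpTail, sum_range_succ']

lemma hasDerivAt_cexpTail (k : ℕ) (z : ℂ) : HasDerivAt (cexpTail k) (cexpTail (k - 1) z) z := by
  unfold cexpTail
  refine (Complex.hasDerivAt_exp z).sub ?_
  cases k with
  | zero => simpa using hasDerivAt_const z (0 : ℂ)
  | succ k =>
    simp only [sum_range_succ' _ k, Nat.add_sub_cancel]
    have h : ∀ i ∈ range k, HasDerivAt (fun z : ℂ => z ^ (i + 1) / (i + 1)!) (z ^ i / i !) z := by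
      intro i _
      have := (hasDerivAt_pow (i + 1) z).div_const ((i + 1)! : ℂ)
      refine this.congr_deriv ?_
      rw [Nat.factorial_succ]
      have : (i ! : ℂ) ≠ 0 := by exact_mod_cast i.factorial_ne_zero
      have : (i + 1 : ℂ) ≠ 0 := by exact_mod_cast i.succ_ne_zero
      push_cast
      field_simp
    simpa using (HasDerivAt.fun_sum h).add_const (1 : ℂ)

/-- The exponential generating function of the probabilities `drawsLaw p (collected k n)`. -/
noncomputable def collectedGenFun {N : ℕ} (p : Fin N → ℝ) (k : Fin N → ℕ) (z : ℂ) : ℂ :=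
  ∏ j, cexpTail (k j) (p j * z)

/-- The product rule reproduces the recursion obtained by conditioning on the last draw, which is
what identifies the Taylor coefficients. -/
lemma hasDerivAt_collectedGenFun {N : ℕ} (p : Fin N → ℝ) (k : Fin N → ℕ) (z : ℂ) :
    HasDerivAt (collectedGenFun p k)
      (∑ i, (p i : ℂ) * collectedGenFun p (k - Pi.single i 1) z) z := by
  have h := HasDerivAt.fun_finsetProd (u := univ) (x := z)
    (f := fun j (z : ℂ) => cexpTail (k j) (p j * z))
    (f' := fun j => cexpTail (k j - 1) (p j * z) * p j)
    fun j _ => (hasDerivAt_cexpTail (k j) (p j * z)).comp z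
      (by simpa using (hasDerivAt_id z).const_mul (p j : ℂ))
  refine HasDerivAt.congr_deriv h (sum_congr rfl fun i _ => ?_)
  rw [collectedGenFun, ← mul_prod_erase _ _ (mem_univ i), smul_eq_mul]
  have : ∏ j ∈ univ.erase i, cexpTail ((k - Pi.single i 1 : Fin N → ℕ) j) (p j * z) =
      ∏ j ∈ univ.erase i, cexpTail (k j) (p j * z) :=
    prod_congr rfl fun j hj => by simp [ne_of_mem_erase hj]
  rw [this]
  simp
  ring

lemma differentiable_collectedGenFun {N : ℕ} (p : Fin N → ℝ) (k : Fin N → ℕ) :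
    Differentiable ℂ (collectedGenFun p k) :=
  fun z => (hasDerivAt_collectedGenFun p k z).differentiableAt

lemma iteratedDeriv_collectedGenFun {N : ℕ} {p : Fin N → ℝ} (hp : ∀ i, 0 ≤ p i)
    (hs : ∑ i, p i = 1) (n : ℕ) (k : Fin N → ℕ) :
    iteratedDeriv n (collectedGenFun p k) 0 = ((drawsLaw p).real (collected k n) : ℂ) := by
  induction n generalizing k with
  | zero =>
    rw [iteratedDeriv_zero, drawsLaw_real_collected_zero hp hs]
    simp only [collectedGenFun, mul_zero, cexpTail_zero_right]
    rw [prod_ite_zero]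
    split_ifs <;> simp_all
  | succ n ih =>
    have hd : deriv (collectedGenFun p k) =
        fun z => ∑ i, (p i : ℂ) * collectedGenFun p (k - Pi.single i 1) z :=
      funext fun z => (hasDerivAt_collectedGenFun p k z).deriv
    have hc : ∀ i : Fin N, ContDiff ℂ n
        (fun z => (p i : ℂ) * collectedGenFun p (k - Pi.single i 1) z) :=
      fun i => (Differentiable.contDiff (differentiable_collectedGenFun p _)).const_smul (p i : ℂ)
    rw [iteratedDeriv_succ', hd, iteratedDeriv_fun_sum fun i _ => (hc i).contDiffAt,
      drawsLaw_real_collected_succ hp hs]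
    push_cast
    refine sum_congr rfl fun i _ => ?_
    rw [iteratedDeriv_const_mul_field, ih]

/-- The exponential series without its first `k` terms, on the reals. -/
noncomputable def expTail (k : ℕ) (x : ℝ) : ℝ := Real.exp x - ∑ i ∈ range k, x ^ i / i !

/-- An entire function equals its Taylor series everywhere; this is the reason for the detour
through ℂ. -/
lemma hasSum_collected {N : ℕ} {p : Fin N → ℝ} (hp : ∀ i, 0 ≤ p i)
    (hs : ∑ i, p i = 1) (k : Fin N → ℕ) (t : ℝ) :
    HasSum (fun n => t ^ n / n ! * (drawsLaw p).real (collected k n))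
      (∏ j, expTail (k j) (p j * t)) := by
  have h := Complex.hasSum_taylorSeries_of_entire (differentiable_collectedGenFun p k) 0 t
  have h1 : collectedGenFun p k t = ((∏ j, expTail (k j) (p j * t) : ℝ) : ℂ) := by
    simp [collectedGenFun, cexpTail, expTail]
  rw [h1] at h
  rw [← Complex.hasSum_ofReal]
  refine h.congr_fun fun n => ?_
  rw [iteratedDeriv_collectedGenFun hp hs]
  simp
  ring

/-! ### Erlang distributions -/

lemma hasSum_expTail (k : ℕ) (x : ℝ) : HasSum (fun i => x ^ (i + k) / (i + k)!) (expTail k x) := by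
  have h := NormedSpace.expSeries_div_hasSum_exp (𝔸 := ℝ) x
  rw [← Real.exp_eq_exp_ℝ] at h
  exact (hasSum_nat_add_iff' k).2 h

lemma expTail_pos (k : ℕ) {x : ℝ} (hx : 0 < x) : 0 < expTail k x := by
  rw [← (hasSum_expTail k x).tsum_eq]
  exact (hasSum_expTail k x).summable.tsum_pos (fun i => by positivity) 0 (by positivity)

lemma expTail_nonneg (k : ℕ) {x : ℝ} (hx : 0 ≤ x) : 0 ≤ expTail k x :=
  (hasSum_expTail k x).nonneg fun i => by positivity

/-- The density of the waiting time for point number `k + 1` of a rate one Poisson process. -/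
noncomputable def erlangPDF (k : ℕ) (x : ℝ) : ℝ := Real.exp (-x) * (x ^ k / k !)

/-- The distribution function of the waiting time for point number `k + 1` of a rate one Poisson
process. -/
noncomputable def erlangCDF (k : ℕ) (x : ℝ) : ℝ := Real.exp (-x) * expTail (k + 1) x

/-- Point `k + 1` is still to come at time `x` exactly when at most `k` points have occurred. The
finite sum makes tails and derivatives explicit. -/
lemma one_sub_erlangCDF (k : ℕ) (x : ℝ) :
    1 - erlangCDF k x = ∑ i ∈ range (k + 1), erlangPDF i x := by
  simp only [erlangCDF, expTail, erlangPDF, ← mul_sum, mul_sub, ← Real.exp_add]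
  simp

lemma erlangPDF_pos (k : ℕ) {x : ℝ} (hx : 0 < x) : 0 < erlangPDF k x := by
  unfold erlangPDF; positivity

lemma erlangPDF_nonneg (k : ℕ) {x : ℝ} (hx : 0 ≤ x) : 0 ≤ erlangPDF k x := by
  unfold erlangPDF; positivity

lemma erlangCDF_pos (k : ℕ) {x : ℝ} (hx : 0 < x) : 0 < erlangCDF k x :=
  mul_pos (Real.exp_pos _) (expTail_pos _ hx)

lemma erlangCDF_nonneg (k : ℕ) {x : ℝ} (hx : 0 ≤ x) : 0 ≤ erlangCDF k x :=
  mul_nonneg (Real.exp_pos _).le (expTail_nonneg _ hx)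

lemma erlangCDF_le_one (k : ℕ) {x : ℝ} (hx : 0 ≤ x) : erlangCDF k x ≤ 1 := by
  have h : 0 ≤ 1 - erlangCDF k x := by
    rw [one_sub_erlangCDF]
    exact sum_nonneg fun i _ => erlangPDF_nonneg i hx
  linarith

lemma hasDerivAt_erlangPDF_zero (x : ℝ) : HasDerivAt (erlangPDF 0) (-erlangPDF 0 x) x := by
  have h : erlangPDF 0 = fun x => Real.exp (-x) := funext fun x => by simp [erlangPDF]
  simpa [h] using (hasDerivAt_neg x).exp

lemma hasDerivAt_erlangPDF_succ (k : ℕ) (x : ℝ) :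
    HasDerivAt (erlangPDF (k + 1)) (erlangPDF k x - erlangPDF (k + 1) x) x := by
  have := ((hasDerivAt_neg x).exp).fun_mul ((hasDerivAt_pow (k + 1) x).div_const ((k + 1)! : ℝ))
  refine this.congr_deriv ?_
  simp only [erlangPDF, Nat.factorial_succ]
  push_cast
  field_simp
  ring

lemma hasDerivAt_erlangCDF (k : ℕ) (x : ℝ) : HasDerivAt (erlangCDF k) (erlangPDF k x) x := by
  have h : erlangCDF k = fun x => 1 - ∑ i ∈ range (k + 1), erlangPDF i x := by
    ext1 x; rw [← one_sub_erlangCDF]; ring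
  have hsum : HasDerivAt (fun x => ∑ i ∈ range (k + 1), erlangPDF i x) (-erlangPDF k x) x := by
    clear h
    induction k with
    | zero => simpa using hasDerivAt_erlangPDF_zero x
    | succ k ih =>
      simp only [sum_range_succ _ (k + 1)]
      exact (ih.fun_add (hasDerivAt_erlangPDF_succ k x)).congr_deriv (by ring)
  rw [h]
  simpa using hsum.const_sub 1

lemma continuous_erlangPDF (k : ℕ) : Continuous (erlangPDF k) := by
  unfold erlangPDF; fun_prop

lemma continuous_erlangCDF (k : ℕ) : Continuous (erlangCDF k) :=
  continuous_iff_continuousAt.2 fun x => (hasDerivAt_erlangCDF k x).continuousAt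

lemma monotoneOn_erlangCDF (k : ℕ) : MonotoneOn (erlangCDF k) (Set.Ici 0) :=
  monotoneOn_of_deriv_nonneg (convex_Ici 0) (continuous_erlangCDF k).continuousOn
    (fun x _ => (hasDerivAt_erlangCDF k x).differentiableAt.differentiableWithinAt)
    fun x hx => by
      rw [(hasDerivAt_erlangCDF k x).deriv]
      exact erlangPDF_nonneg k (interior_subset hx)

lemma integrableOn_pow_mul_exp_neg (n : ℕ) {c : ℝ} (hc : 0 < c) :
    IntegrableOn (fun t : ℝ => t ^ n * Real.exp (-(c * t))) (Set.Ioi 0) := by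
  have h := integrableOn_rpow_mul_exp_neg_mul_rpow (p := 1) (s := n) (b := c)
    (by have : (0 : ℝ) ≤ n := n.cast_nonneg
        linarith) one_pos hc
  simpa using h

lemma integrableOn_pow_mul_erlangPDF (n k : ℕ) {c : ℝ} (hc : 0 < c) :
    IntegrableOn (fun t : ℝ => t ^ n * erlangPDF k (c * t)) (Set.Ioi 0) := by
  refine ((integrableOn_pow_mul_exp_neg (n + k) hc).const_mul (c ^ k / k !)).congr ?_
  refine Eventually.of_forall fun t => ?_
  simp only [erlangPDF]
  ring

lemma integrableOn_pow_mul_one_sub_erlangCDF (n k : ℕ) {c : ℝ} (hc : 0 < c) :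
    IntegrableOn (fun t : ℝ => t ^ n * (1 - erlangCDF k (c * t))) (Set.Ioi 0) := by
  simp only [one_sub_erlangCDF, mul_sum]
  exact integrable_finsetSum _ fun i _ => integrableOn_pow_mul_erlangPDF n i hc

lemma tendsto_pow_mul_one_sub_erlangCDF (n k : ℕ) {c : ℝ} (hc : 0 < c) :
    Tendsto (fun t : ℝ => t ^ n * (1 - erlangCDF k (c * t))) atTop (𝓝 0) := by
  simp only [one_sub_erlangCDF, mul_sum]
  rw [← sum_const_zero (s := range (k + 1))]
  refine tendsto_finsetSum _ fun i _ => ?_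
  have h := ((Real.tendsto_pow_mul_exp_neg_atTop_nhds_zero (n + i)).comp
    (tendsto_id.const_mul_atTop hc)).mul_const ((c ^ n)⁻¹ / i !)
  rw [zero_mul] at h
  refine h.congr fun t => ?_
  simp only [Function.comp, id, erlangPDF]
  have : c ^ n ≠ 0 := by positivity
  field_simp
  ring

lemma setLIntegral_pow_mul_erlangPDF (r n : ℕ) :
    ∫⁻ t in Set.Ioi (0 : ℝ), ENNReal.ofReal (t ^ r * erlangPDF n t) =
      ENNReal.ofReal ((n + r)! / n !) := by
  have hint := integrableOn_pow_mul_erlangPDF r n one_pos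
  simp only [one_mul] at hint
  rw [← ofReal_integral_eq_lintegral_ofReal hint]
  · congr 1
    have h : ∀ t : ℝ, t ^ r * erlangPDF n t = (n ! : ℝ)⁻¹ * (Real.exp (-t) * t ^ (n + r)) := by
      intro t
      simp only [erlangPDF]
      ring
    simp only [h]
    rw [integral_const_mul]
    have hG := Real.Gamma_eq_integral (s := (n + r : ℕ) + 1) (by positivity)
    rw [Real.Gamma_nat_eq_factorial] at hG
    simp only [add_sub_cancel_right, Real.rpow_natCast] at hG
    rw [← hG]
    ring
  · filter_upwards [ae_restrict_mem measurableSet_Ioi] with t ht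
    exact mul_nonneg (pow_nonneg (le_of_lt ht) _) (erlangPDF_nonneg n (le_of_lt ht))

/-! ### The continuous-time completion time -/

/-- The distribution function of the maximum of independent Erlang times with rates `p j`. -/
noncomputable def maxCDF {N : ℕ} (k : ℕ) (p : Fin N → ℝ) (t : ℝ) : ℝ :=
  ∏ j, erlangCDF k (p j * t)

lemma maxCDF_le_one {N : ℕ} (k : ℕ) {p : Fin N → ℝ} (hp : ∀ i, 0 ≤ p i) {t : ℝ} (ht : 0 ≤ t) :
    maxCDF k p t ≤ 1 :=
  prod_le_one (fun j _ => erlangCDF_nonneg k (mul_nonneg (hp j) ht))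
    fun j _ => erlangCDF_le_one k (mul_nonneg (hp j) ht)

lemma continuous_maxCDF {N : ℕ} (k : ℕ) (p : Fin N → ℝ) : Continuous (maxCDF k p) :=
  continuous_finsetProd _ fun j _ => (continuous_erlangCDF k).comp (continuous_const_mul (p j))

lemma one_sub_prod_le {ι : Type*} (s : Finset ι) (f : ι → ℝ) (h0 : ∀ i ∈ s, 0 ≤ f i)
    (h1 : ∀ i ∈ s, f i ≤ 1) : 1 - ∏ i ∈ s, f i ≤ ∑ i ∈ s, (1 - f i) := by
  classical
  induction s using Finset.induction_on with
  | empty => simp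
  | insert a s ha ih =>
    rw [prod_insert ha, sum_insert ha]
    have h2 := ih (fun i hi => h0 i (mem_insert_of_mem hi)) fun i hi => h1 i (mem_insert_of_mem hi)
    have h3 : ∏ i ∈ s, f i ≤ 1 := prod_le_one (fun i hi => h0 i (mem_insert_of_mem hi))
      fun i hi => h1 i (mem_insert_of_mem hi)
    have := h0 a (mem_insert_self a s)
    have := h1 a (mem_insert_self a s)
    nlinarith

/-- Union bound, with every rate replaced by the lower bound `c`; it transfers exponential decay of
Erlang tails to the maximum. -/
lemma one_sub_maxCDF_le {N : ℕ} (k : ℕ) {p : Fin N → ℝ} {c : ℝ} (hc : 0 ≤ c)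
    (hp : ∀ i, c ≤ p i) {t : ℝ} (ht : 0 ≤ t) :
    1 - maxCDF k p t ≤ N * (1 - erlangCDF k (c * t)) := by
  refine (one_sub_prod_le _ _
    (fun j _ => erlangCDF_nonneg k (mul_nonneg (hc.trans (hp j)) ht))
    fun j _ => erlangCDF_le_one k (mul_nonneg (hc.trans (hp j)) ht)).trans ?_
  have : (N : ℝ) * (1 - erlangCDF k (c * t)) = ∑ _j : Fin N, (1 - erlangCDF k (c * t)) := by
    rw [sum_const, card_univ, Fintype.card_fin, nsmul_eq_mul]
  rw [this]
  refine sum_le_sum fun j _ => sub_le_sub_left ?_ 1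
  exact monotoneOn_erlangCDF k (Set.mem_Ici.2 (mul_nonneg hc ht))
    (Set.mem_Ici.2 (mul_nonneg (hc.trans (hp j)) ht)) (mul_le_mul_of_nonneg_right (hp j) ht)

lemma exists_pos_forall_le {N : ℕ} {p : Fin N → ℝ} (hp : ∀ i, 0 < p i) :
    ∃ c, 0 < c ∧ ∀ i, c ≤ p i := by
  rcases isEmpty_or_nonempty (Fin N) with h | h
  · exact ⟨1, one_pos, fun i => h.elim i⟩
  · obtain ⟨i, hi⟩ := Finite.exists_min p
    exact ⟨p i, hp i, hi⟩

lemma integrableOn_pow_mul_one_sub_maxCDF {N : ℕ} (n k : ℕ) {p : Fin N → ℝ}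
    (hp : ∀ i, 0 < p i) :
    IntegrableOn (fun t : ℝ => t ^ n * (1 - maxCDF k p t)) (Set.Ioi 0) := by
  obtain ⟨c, hc, hcp⟩ := exists_pos_forall_le hp
  refine ((integrableOn_pow_mul_one_sub_erlangCDF n k hc).const_mul (N : ℝ)).mono' ?_ ?_
  · exact ((continuous_pow n).mul
      (continuous_const.sub (continuous_maxCDF k p))).aestronglyMeasurable
  · filter_upwards [ae_restrict_mem measurableSet_Ioi] with t ht
    have ht' : (0 : ℝ) ≤ t := le_of_lt ht
    rw [Real.norm_of_nonneg (mul_nonneg (pow_nonneg ht' n)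
      (sub_nonneg.2 (maxCDF_le_one k (fun i => (hp i).le) ht')))]
    calc t ^ n * (1 - maxCDF k p t) ≤ t ^ n * (N * (1 - erlangCDF k (c * t))) :=
          mul_le_mul_of_nonneg_left (one_sub_maxCDF_le k hc.le hcp ht') (pow_nonneg ht' n)
      _ = _ := by ring

lemma tendsto_pow_mul_one_sub_maxCDF {N : ℕ} (n k : ℕ) {p : Fin N → ℝ} (hp : ∀ i, 0 < p i) :
    Tendsto (fun t : ℝ => t ^ n * (1 - maxCDF k p t)) atTop (𝓝 0) := by
  obtain ⟨c, hc, hcp⟩ := exists_pos_forall_le hp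
  have h := (tendsto_pow_mul_one_sub_erlangCDF n k hc).const_mul (N : ℝ)
  rw [mul_zero] at h
  refine tendsto_of_tendsto_of_tendsto_of_le_of_le' tendsto_const_nhds h ?_ ?_
  · filter_upwards [eventually_ge_atTop 0] with t ht
    exact mul_nonneg (pow_nonneg ht n)
      (sub_nonneg.2 (maxCDF_le_one k (fun i => (hp i).le) ht))
  · filter_upwards [eventually_ge_atTop 0] with t ht
    calc t ^ n * (1 - maxCDF k p t) ≤ t ^ n * (N * (1 - erlangCDF k (c * t))) :=
          mul_le_mul_of_nonneg_left (one_sub_maxCDF_le k hc.le hcp ht) (pow_nonneg ht n)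
      _ = _ := by ring

/-! ### Moments of the completion time -/

/-- Poissonization: the number of draws at time `t` has the Poisson law with mean `t`. -/
lemma hasSum_not_collected {N : ℕ} (k : ℕ) {p : Fin N → ℝ} (hp : ∀ i, 0 ≤ p i)
    (hs : ∑ i, p i = 1) (t : ℝ) :
    HasSum (fun n => erlangPDF n t * (drawsLaw p).real (collected (fun _ => k + 1) n)ᶜ)
      (1 - maxCDF k p t) := by
  have := isProbabilityMeasure_drawsLaw hp hs
  have h0 := hasSum_expTail 0 t
  have h1 := (h0.sub (hasSum_collected hp hs (fun _ => k + 1) t)).mul_left (Real.exp (-t))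
  have h2 : Real.exp (-t) * (expTail 0 t - ∏ j, expTail (k + 1) (p j * t)) =
      1 - maxCDF k p t := by
    have : Real.exp (-t) = ∏ j, Real.exp (-(p j * t)) := by
      rw [← Real.exp_sum, sum_neg_distrib, ← sum_mul, hs, one_mul]
    rw [mul_sub]
    congr 1
    · simp [expTail, ← Real.exp_add]
    · rw [this, ← prod_mul_distrib]
      rfl
  rw [h2] at h1
  refine h1.congr_fun fun n => ?_
  rw [probReal_compl_eq_one_sub (measurableSet_collected _ n), erlangPDF]
  simp
  ring

/-- Tonelli applied to the Poisson mixture; the weights are Gamma integrals, which turn powers of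
continuous time into rising factorials of discrete time. -/
lemma setLIntegral_pow_mul_one_sub_maxCDF {N : ℕ} (r k : ℕ) {p : Fin N → ℝ} (hp : ∀ i, 0 ≤ p i)
    (hs : ∑ i, p i = 1) :
    ∫⁻ t in Set.Ioi (0 : ℝ), ENNReal.ofReal (t ^ r * (1 - maxCDF k p t)) =
      ∑' n, ENNReal.ofReal ((n + r)! / n !) * drawsLaw p (collected (fun _ => k + 1) n)ᶜ := by
  have := isProbabilityMeasure_drawsLaw hp hs
  have h1 : ∫⁻ t in Set.Ioi (0 : ℝ), ENNReal.ofReal (t ^ r * (1 - maxCDF k p t)) =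
      ∫⁻ t in Set.Ioi (0 : ℝ), ∑' n, ENNReal.ofReal (t ^ r * erlangPDF n t) *
        drawsLaw p (collected (fun _ => k + 1) n)ᶜ := by
    refine setLIntegral_congr_fun measurableSet_Ioi fun t ht => ?_
    have ht' : (0 : ℝ) ≤ t := le_of_lt ht
    have h := (hasSum_not_collected k hp hs t).mul_left (t ^ r)
    have hnn : ∀ n, 0 ≤ t ^ r * (erlangPDF n t *
        (drawsLaw p).real (collected (fun _ => k + 1) n)ᶜ) := fun n =>
      mul_nonneg (pow_nonneg ht' r) (mul_nonneg (erlangPDF_nonneg n ht') measureReal_nonneg)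
    rw [← h.tsum_eq, ENNReal.ofReal_tsum_of_nonneg hnn h.summable]
    refine tsum_congr fun n => ?_
    rw [← mul_assoc, ENNReal.ofReal_mul (mul_nonneg (pow_nonneg ht' r) (erlangPDF_nonneg n ht')),
      ofReal_measureReal]
  rw [h1, lintegral_tsum]
  · refine tsum_congr fun n => ?_
    rw [lintegral_mul_const, setLIntegral_pow_mul_erlangPDF]
    exact ((continuous_pow r).mul (continuous_erlangPDF n)).measurable.ennreal_ofReal
  · intro n
    exact (((continuous_pow r).mul
      (continuous_erlangPDF n)).measurable.ennreal_ofReal.mul_const _).aemeasurable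

lemma ae_completionTime_ne_top {N : ℕ} (k : ℕ) {p : Fin N → ℝ} (hp : ∀ i, 0 < p i)
    (hs : ∑ i, p i = 1) : ∀ᵐ ω ∂(drawsLaw p), completionTime (k + 1) ω ≠ ⊤ := by
  have h := setLIntegral_pow_mul_one_sub_maxCDF 0 k (fun i => (hp i).le) hs
  have hfin := (integrableOn_pow_mul_one_sub_maxCDF 0 k hp).lintegral_lt_top
  rw [h] at hfin
  -- For `r = 0` the weights are `1`, so convergence of the series forces the probability of being
  -- unfinished to tend to zero.
  have h0 := ENNReal.tendsto_atTop_zero_of_tsum_ne_top hfin.ne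
  have hle : ∀ n, drawsLaw p {ω | completionTime (k + 1) ω = ⊤} ≤
      ENNReal.ofReal ((n + 0)! / n !) * drawsLaw p (collected (fun _ => k + 1) n)ᶜ := by
    intro n
    rw [add_zero, div_self (by positivity), ENNReal.ofReal_one, one_mul]
    exact measure_mono fun ω hω => (completionTime_eq_top_iff _ ω).1 hω n
  have : drawsLaw p {ω | completionTime (k + 1) ω = ⊤} ≤ 0 := ge_of_tendsto' h0 hle
  rw [ae_iff]
  simpa using this

lemma lintegral_sum_range_toNat_completionTime {N : ℕ} (k : ℕ) {p : Fin N → ℝ}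
    (hp : ∀ i, 0 < p i) (hs : ∑ i, p i = 1) {a : ℕ → ℝ} (ha : ∀ n, 0 ≤ a n) :
    ∫⁻ ω, ENNReal.ofReal (∑ n ∈ range (completionTime (k + 1) ω).toNat, a n) ∂(drawsLaw p) =
      ∑' n, ENNReal.ofReal (a n) * drawsLaw p (collected (fun _ => k + 1) n)ᶜ := by
  have h1 : ∀ᵐ ω ∂(drawsLaw p),
      ENNReal.ofReal (∑ n ∈ range (completionTime (k + 1) ω).toNat, a n) =
        ∑' n, (collected (fun _ => k + 1) n)ᶜ.indicator (fun _ => ENNReal.ofReal (a n)) ω := by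
    filter_upwards [ae_completionTime_ne_top k hp hs] with ω hω
    obtain ⟨l, hl⟩ := ENat.ne_top_iff_exists.1 hω
    have hmem : ∀ n, ω ∈ (collected (fun _ => k + 1) n)ᶜ ↔ n ∈ range l := by
      intro n
      rw [Set.mem_compl_iff, ← completionTime_le_iff, ← hl, mem_range]
      simp
    rw [← hl, ENat.toNat_natCast, ENNReal.ofReal_sum_of_nonneg fun n _ => ha n,
      tsum_eq_sum (s := range l)]
    · refine sum_congr rfl fun n hn => ?_
      rw [Set.indicator_of_mem ((hmem n).2 hn)]
    · exact fun n hn => Set.indicator_of_notMem (fun h => hn ((hmem n).1 h)) _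
  rw [lintegral_congr_ae h1, lintegral_tsum]
  · refine tsum_congr fun n => ?_
    rw [lintegral_indicator_const (measurableSet_collected _ n).compl]
  · exact fun n => (measurable_const.indicator (measurableSet_collected _ n).compl).aemeasurable

/-- The sum is T for `r = 0` and T(T+1)/2 for `r = 1`, the two moments that the variance needs. -/
lemma integrable_and_integral_sum_range_toNat_completionTime {N : ℕ} (r k : ℕ) {p : Fin N → ℝ}
    (hp : ∀ i, 0 < p i) (hs : ∑ i, p i = 1) :
    Integrable (fun ω => ∑ n ∈ range (completionTime (k + 1) ω).toNat, ((n + r)! / n ! : ℝ))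
        (drawsLaw p) ∧
      ∫ ω, ∑ n ∈ range (completionTime (k + 1) ω).toNat, ((n + r)! / n ! : ℝ) ∂(drawsLaw p) =
        ∫ t in Set.Ioi (0 : ℝ), t ^ r * (1 - maxCDF k p t) := by
  have h1 := lintegral_sum_range_toNat_completionTime k hp hs
    (a := fun n => ((n + r)! / n ! : ℝ)) fun n => by positivity
  rw [← setLIntegral_pow_mul_one_sub_maxCDF r k (fun i => (hp i).le) hs] at h1
  have hint := integrableOn_pow_mul_one_sub_maxCDF r k hp
  have hnn : ∀ ω : ℕ → Fin N,
      (0 : ℝ) ≤ ∑ n ∈ range (completionTime (k + 1) ω).toNat, ((n + r)! / n ! : ℝ) :=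
    fun ω => sum_nonneg fun n _ => by positivity
  have hmeas : Measurable fun ω : ℕ → Fin N =>
      ∑ n ∈ range (completionTime (k + 1) ω).toNat, ((n + r)! / n ! : ℝ) :=
    (measurable_of_countable fun l : ℕ => ∑ n ∈ range l, ((n + r)! / n ! : ℝ)).comp
      (measurable_toNat_completionTime (k + 1))
  constructor
  · refine ⟨hmeas.aestronglyMeasurable, ?_⟩
    rw [hasFiniteIntegral_iff_ofReal (Eventually.of_forall hnn), h1]
    exact hint.lintegral_lt_top
  · rw [integral_eq_lintegral_of_nonneg_ae (Eventually.of_forall hnn) hmeas.aestronglyMeasurable,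
      h1, ← integral_eq_lintegral_of_nonneg_ae _ hint.aestronglyMeasurable]
    filter_upwards [ae_restrict_mem measurableSet_Ioi] with t ht
    exact mul_nonneg (pow_nonneg (le_of_lt ht) r)
      (sub_nonneg.2 (maxCDF_le_one k (fun i => (hp i).le) (le_of_lt ht)))

/-- The moment `∫ t ^ r * P (X > t) dt` of the continuous-time completion time `X`. -/
noncomputable def tailMoment {N : ℕ} (r k : ℕ) (p : Fin N → ℝ) : ℝ :=
  ∫ t in Set.Ioi (0 : ℝ), t ^ r * (1 - maxCDF k p t)

lemma integrable_realTime {N : ℕ} (k : ℕ) {p : Fin N → ℝ} (hp : ∀ i, 0 < p i)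
    (hs : ∑ i, p i = 1) : Integrable (realTime (k + 1)) (drawsLaw p) ∧
      ∫ ω, realTime (k + 1) ω ∂(drawsLaw p) = tailMoment 0 k p := by
  have h := integrable_and_integral_sum_range_toNat_completionTime 0 k hp hs
  have h' : (fun ω : ℕ → Fin N =>
      ∑ n ∈ range (completionTime (k + 1) ω).toNat, ((n + 0)! / n ! : ℝ)) = realTime (k + 1) := by
    ext1 ω
    have : ∀ n : ℕ, ((n + 0)! / n ! : ℝ) = 1 := fun n => div_self (by positivity)
    simp only [this, realTime]
    simp
  rw [h'] at h
  exact h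

lemma integrable_realTime_sq_add {N : ℕ} (k : ℕ) {p : Fin N → ℝ} (hp : ∀ i, 0 < p i)
    (hs : ∑ i, p i = 1) :
    Integrable (fun ω => realTime (k + 1) ω ^ 2 + realTime (k + 1) ω) (drawsLaw p) ∧
      ∫ ω, (realTime (k + 1) ω ^ 2 + realTime (k + 1) ω) ∂(drawsLaw p) = 2 * tailMoment 1 k p := by
  have h := integrable_and_integral_sum_range_toNat_completionTime 1 k hp hs
  have h' : (fun ω : ℕ → Fin N => realTime (k + 1) ω ^ 2 + realTime (k + 1) ω) = fun ω => 2 *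
      ∑ n ∈ range (completionTime (k + 1) ω).toNat, ((n + 1)! / n ! : ℝ) := by
    ext1 ω
    have : ∀ n : ℕ, ((n + 1)! / n ! : ℝ) = n + 1 := fun n => by
      rw [Nat.factorial_succ]; push_cast; field_simp
    simp only [realTime, this]
    induction (completionTime (k + 1) ω).toNat with
    | zero => simp
    | succ l ih =>
      rw [sum_range_succ, mul_add, ← ih]
      push_cast
      ring
  rw [h', integral_const_mul, h.2]
  exact ⟨h.1.const_mul 2, rfl⟩

lemma memLp_realTime {N : ℕ} (k : ℕ) {p : Fin N → ℝ} (hp : ∀ i, 0 < p i)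
    (hs : ∑ i, p i = 1) : MemLp (realTime (k + 1)) 2 (drawsLaw p) := by
  have h := integrable_realTime k hp hs
  rw [memLp_two_iff_integrable_sq h.1.aestronglyMeasurable]
  refine ((integrable_realTime_sq_add k hp hs).1.sub h.1).congr (Eventually.of_forall fun ω => ?_)
  simp

lemma timeVariance_eq {N : ℕ} (k : ℕ) {p : Fin N → ℝ} (hp : ∀ i, 0 < p i)
    (hs : ∑ i, p i = 1) :
    timeVariance (k + 1) p = 2 * tailMoment 1 k p - tailMoment 0 k p - tailMoment 0 k p ^ 2 := by
  have := isProbabilityMeasure_drawsLaw (fun i => (hp i).le) hs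
  have h1 := integrable_realTime k hp hs
  have h2 := integrable_realTime_sq_add k hp hs
  have hL := memLp_realTime k hp hs
  rw [timeVariance, variance_eq_sub hL, h1.2, ← h2.2, integral_add hL.integrable_sq h1.1, h1.2]
  simp

/-! ### Derivatives of the distribution function -/

/-- The derivative of `∏ j, erlangCDF k (x j)` in direction `q`, at `x = t • p`. -/
noncomputable def maxSlope {N : ℕ} (k : ℕ) (p q : Fin N → ℝ) (t : ℝ) : ℝ :=
  ∑ j, q j * (erlangPDF k (p j * t) * ∏ i ∈ univ.erase j, erlangCDF k (p i * t))

lemma hasDerivAt_prod_erlangCDF {N : ℕ} (k : ℕ) {a : Fin N → ℝ → ℝ} {a' : Fin N → ℝ} {x : ℝ}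
    (ha : ∀ j, HasDerivAt (a j) (a' j) x) :
    HasDerivAt (fun x => ∏ j, erlangCDF k (a j x))
      (∑ j, a' j * (erlangPDF k (a j x) * ∏ i ∈ univ.erase j, erlangCDF k (a i x))) x := by
  have h := HasDerivAt.fun_finsetProd (u := univ) (x := x)
    (f := fun j x => erlangCDF k (a j x)) (f' := fun j => erlangPDF k (a j x) * a' j)
    fun j _ => (hasDerivAt_erlangCDF k (a j x)).comp x (ha j)
  refine h.congr_deriv (sum_congr rfl fun j _ => ?_)
  rw [smul_eq_mul]
  ring

lemma hasDerivAt_maxCDF {N : ℕ} (k : ℕ) (p : Fin N → ℝ) (t : ℝ) :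
    HasDerivAt (maxCDF k p) (maxSlope k p p t) t :=
  hasDerivAt_prod_erlangCDF k (a := fun j t => p j * t) fun j => by
    simpa using (hasDerivAt_id t).const_mul (p j)

lemma hasDerivAt_maxCDF_line {N : ℕ} (k : ℕ) (p q : Fin N → ℝ) (t θ : ℝ) :
    HasDerivAt (fun θ : ℝ => maxCDF k (p + θ • q) t) (t * maxSlope k (p + θ • q) q t) θ := by
  have h := hasDerivAt_prod_erlangCDF k (a := fun j θ => (p + θ • q) j * t) (x := θ)
    (a' := fun j => q j * t) fun j => by
      simpa using (((hasDerivAt_id θ).mul_const (q j)).const_add (p j)).mul_const t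
  refine h.congr_deriv ?_
  rw [maxSlope, mul_sum]
  exact sum_congr rfl fun j _ => by ring

lemma continuous_maxSlope {N : ℕ} (k : ℕ) (p q : Fin N → ℝ) : Continuous (maxSlope k p q) := by
  have h1 := continuous_erlangPDF k
  have h2 := continuous_erlangCDF k
  unfold maxSlope
  fun_prop

lemma maxSlope_smul {N : ℕ} (k : ℕ) (p q : Fin N → ℝ) (a t : ℝ) :
    maxSlope k p (a • q) t = a * maxSlope k p q t := by
  simp only [maxSlope, mul_sum, Pi.smul_apply, smul_eq_mul, mul_assoc]

lemma maxSlope_sub {N : ℕ} (k : ℕ) (p q q' : Fin N → ℝ) (t : ℝ) :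
    maxSlope k p (q - q') t = maxSlope k p q t - maxSlope k p q' t := by
  simp only [maxSlope, ← sum_sub_distrib, Pi.sub_apply, sub_mul]

lemma abs_maxSlope_le {N : ℕ} (k : ℕ) {p : Fin N → ℝ} (hp : ∀ i, 0 ≤ p i) (q : Fin N → ℝ)
    {t : ℝ} (ht : 0 ≤ t) : |maxSlope k p q t| ≤ ∑ j, |q j| * erlangPDF k (p j * t) := by
  refine (abs_sum_le_sum_abs _ _).trans (sum_le_sum fun j _ => ?_)
  rw [abs_mul]
  have h1 := erlangPDF_nonneg k (mul_nonneg (hp j) ht)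
  have h2 : ∀ i ∈ univ.erase j, 0 ≤ erlangCDF k (p i * t) :=
    fun i _ => erlangCDF_nonneg k (mul_nonneg (hp i) ht)
  rw [abs_of_nonneg (mul_nonneg h1 (prod_nonneg h2))]
  exact mul_le_mul_of_nonneg_left (mul_le_of_le_one_right h1
    (prod_le_one h2 fun i _ => erlangCDF_le_one k (mul_nonneg (hp i) ht))) (abs_nonneg _)

lemma integrableOn_pow_mul_maxSlope {N : ℕ} (n k : ℕ) {p : Fin N → ℝ} (hp : ∀ i, 0 < p i)
    (q : Fin N → ℝ) : IntegrableOn (fun t : ℝ => t ^ n * maxSlope k p q t) (Set.Ioi 0) := by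
  have hint : IntegrableOn (fun t : ℝ => ∑ j, |q j| * (t ^ n * erlangPDF k (p j * t)))
      (Set.Ioi 0) :=
    integrable_finsetSum _ fun j _ => (integrableOn_pow_mul_erlangPDF n k (hp j)).const_mul _
  refine hint.mono' ((continuous_pow n).mul (continuous_maxSlope k p q)).aestronglyMeasurable ?_
  filter_upwards [ae_restrict_mem measurableSet_Ioi] with t ht
  have ht' : (0 : ℝ) ≤ t := le_of_lt ht
  rw [Real.norm_eq_abs, abs_mul, abs_of_nonneg (pow_nonneg ht' n)]
  refine (mul_le_mul_of_nonneg_left (abs_maxSlope_le k (fun i => (hp i).le) q ht')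
    (pow_nonneg ht' n)).trans_eq ?_
  rw [mul_sum]
  exact sum_congr rfl fun j _ => by ring

/-- Integration by parts for the moments of the continuous-time completion time. -/
lemma integral_pow_succ_mul_maxSlope {N : ℕ} (r k : ℕ) {p : Fin N → ℝ} (hp : ∀ i, 0 < p i) :
    ∫ t in Set.Ioi (0 : ℝ), t ^ (r + 1) * maxSlope k p p t = (r + 1) * tailMoment r k p := by
  have h1 := (integrableOn_pow_mul_one_sub_maxCDF r k hp).const_mul (r + 1 : ℝ)
  have h2 := integrableOn_pow_mul_maxSlope (r + 1) k hp p
  have h := integral_Ioi_of_hasDerivAt_of_tendsto' (a := 0)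
    (f := fun t => t ^ (r + 1) * (1 - maxCDF k p t))
    (f' := fun t => (r + 1) * (t ^ r * (1 - maxCDF k p t)) - t ^ (r + 1) * maxSlope k p p t)
    (fun t _ => by
      refine ((hasDerivAt_pow (r + 1) t).fun_mul
        ((hasDerivAt_maxCDF k p t).const_sub 1)).congr_deriv ?_
      push_cast
      ring)
    (h1.sub h2) (tendsto_pow_mul_one_sub_maxCDF (r + 1) k hp)
  rw [integral_sub h1 h2, integral_const_mul] at h
  rw [tailMoment]
  simp at h
  linarith

/-- Differentiation of the moments along a line. -/
lemma hasDerivAt_tailMoment_line {N : ℕ} (r k : ℕ) (p q : Fin N → ℝ) {θ : ℝ}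
    (hp : ∀ i, 0 < (p + θ • q) i) :
    HasDerivAt (fun θ : ℝ => tailMoment r k (p + θ • q))
      (-∫ t in Set.Ioi (0 : ℝ), t ^ (r + 1) * maxSlope k (p + θ • q) q t) θ := by
  obtain ⟨c, hc, hcp⟩ := exists_pos_forall_le hp
  have hc2 : 0 < c / 2 := by positivity
  -- Near `θ` the lower bound on the rates controls the exponential factor and the upper bound
  -- controls the power, which gives one integrable majorant.
  have hs : ∀ᶠ x : ℝ in 𝓝 θ, ∀ i, c / 2 < (p + x • q) i ∧ (p + x • q) i < (p + θ • q) i + 1 := by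
    refine eventually_all.2 fun i => ?_
    have hcont : ContinuousAt (fun x : ℝ => (p + x • q) i) θ := by
      simp only [Pi.add_apply, Pi.smul_apply, smul_eq_mul]
      fun_prop
    exact (hcont.eventually_const_lt ((half_lt_self hc).trans_le (hcp i))).and
      (hcont.eventually_lt_const (lt_add_one _))
  have h := hasDerivAt_integral_of_dominated_loc_of_deriv_le (x₀ := θ)
    (μ := volume.restrict (Set.Ioi (0 : ℝ)))
    (F := fun (x : ℝ) t => t ^ r * (1 - maxCDF k (p + x • q) t))
    (F' := fun (x : ℝ) t => -(t ^ (r + 1) * maxSlope k (p + x • q) q t))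
    (bound := fun t => ∑ j, |q j| * (((p + θ • q) j + 1) ^ k / k !) *
      (t ^ (r + 1 + k) * Real.exp (-(c / 2 * t))))
    hs ?_ (integrableOn_pow_mul_one_sub_maxCDF r k hp) ?_ ?_ ?_ ?_
  · rw [← integral_neg]
    exact h.2
  · exact Eventually.of_forall fun x => ((continuous_pow r).mul
      (continuous_const.sub (continuous_maxCDF k _))).aestronglyMeasurable
  · exact ((continuous_pow _).mul (continuous_maxSlope k _ q)).neg.aestronglyMeasurable
  · filter_upwards [ae_restrict_mem measurableSet_Ioi] with t ht x hx
    have ht' : (0 : ℝ) < t := ht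
    have hx0 : ∀ i, 0 < (p + x • q) i := fun i => hc2.trans (hx i).1
    rw [norm_neg, Real.norm_eq_abs, abs_mul, abs_of_nonneg (by positivity)]
    refine (mul_le_mul_of_nonneg_left (abs_maxSlope_le k (fun i => (hx0 i).le) q ht'.le)
      (by positivity)).trans ?_
    rw [mul_sum]
    refine sum_le_sum fun j _ => ?_
    have h1 : erlangPDF k ((p + x • q) j * t) ≤
        Real.exp (-(c / 2 * t)) * ((((p + θ • q) j + 1) * t) ^ k / k !) := by
      unfold erlangPDF
      have := hx0 j
      have := (hx j).1.le
      have := (hx j).2.le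
      gcongr
    calc t ^ (r + 1) * (|q j| * erlangPDF k ((p + x • q) j * t))
        ≤ t ^ (r + 1) * (|q j| *
          (Real.exp (-(c / 2 * t)) * ((((p + θ • q) j + 1) * t) ^ k / k !))) := by gcongr
      _ = _ := by rw [mul_pow]; ring
  · exact integrable_finsetSum _ fun j _ => (integrableOn_pow_mul_exp_neg _ hc2).const_mul _
  · refine Eventually.of_forall fun t x _ => ?_
    refine (((hasDerivAt_maxCDF_line k p q t x).const_sub 1).const_mul (t ^ r)).congr_deriv ?_
    ring

/-! ### The reversed hazard rate of an Erlang distribution -/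

lemma sum_sum_nonneg_of_add_swap_nonneg {ι : Type*} (s : Finset ι) (f : ι → ι → ℝ)
    (h : ∀ i ∈ s, ∀ j ∈ s, 0 ≤ f i j + f j i) : 0 ≤ ∑ i ∈ s, ∑ j ∈ s, f i j := by
  have h1 : 0 ≤ ∑ i ∈ s, ∑ j ∈ s, (f i j + f j i) :=
    sum_nonneg fun i hi => sum_nonneg fun j hj => h i hi j hj
  simp only [sum_add_distrib] at h1
  rw [sum_comm (f := fun i j => f j i)] at h1
  linarith

lemma pow_mul_pow_le_of_le {a b : ℝ} (ha : 0 ≤ a) (hab : a ≤ b) {i j : ℕ} (hij : i ≤ j) :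
    a ^ j * b ^ i ≤ a ^ i * b ^ j := by
  obtain ⟨l, rfl⟩ := Nat.exists_eq_add_of_le hij
  have hb := ha.trans hab
  calc a ^ (i + l) * b ^ i = a ^ i * b ^ i * a ^ l := by ring
    _ ≤ a ^ i * b ^ i * b ^ l := by gcongr
    _ = a ^ i * b ^ (i + l) := by ring

/-- A power series with nonnegative coefficients is totally positive of order two in the product
of two variables. -/
lemma sum_mul_sum_le_of_le (c : ℕ → ℝ) (hc : ∀ i, 0 ≤ c i) {a b s t : ℝ} (ha : 0 ≤ a)
    (hab : a ≤ b) (hs : 0 ≤ s) (hst : s ≤ t) (n : ℕ) :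
    (∑ i ∈ range n, c i * (a * t) ^ i) * ∑ i ∈ range n, c i * (b * s) ^ i ≤
      (∑ i ∈ range n, c i * (a * s) ^ i) * ∑ i ∈ range n, c i * (b * t) ^ i := by
  rw [← sub_nonneg]
  simp only [sum_mul_sum, ← sum_sub_distrib]
  refine sum_sum_nonneg_of_add_swap_nonneg _ _ fun i _ j _ => ?_
  -- Adding the terms for (i, j) and (j, i) leaves a product of two 2 × 2 minors, whose signs agree.
  have h : c i * (a * s) ^ i * (c j * (b * t) ^ j) - c i * (a * t) ^ i * (c j * (b * s) ^ j) +
      (c j * (a * s) ^ j * (c i * (b * t) ^ i) - c j * (a * t) ^ j * (c i * (b * s) ^ i)) =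
      c i * c j * ((a ^ i * b ^ j - a ^ j * b ^ i) * (s ^ i * t ^ j - s ^ j * t ^ i)) := by
    simp only [mul_pow]
    ring
  rw [h]
  refine mul_nonneg (mul_nonneg (hc i) (hc j)) ?_
  rcases le_total i j with hij | hij
  · exact mul_nonneg (sub_nonneg.2 (pow_mul_pow_le_of_le ha hab hij))
      (sub_nonneg.2 (pow_mul_pow_le_of_le hs hst hij))
  · exact mul_nonneg_of_nonpos_of_nonpos (sub_nonpos.2 (pow_mul_pow_le_of_le ha hab hij))
      (sub_nonpos.2 (pow_mul_pow_le_of_le hs hst hij))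

lemma expTail_mul_expTail_le (k : ℕ) {a b s t : ℝ} (ha : 0 ≤ a) (hab : a ≤ b) (hs : 0 ≤ s)
    (hst : s ≤ t) :
    expTail k (a * t) * expTail k (b * s) ≤ expTail k (a * s) * expTail k (b * t) := by
  have h : ∀ x, Tendsto (fun n => ∑ i ∈ range n, (if k ≤ i then (i ! : ℝ)⁻¹ else 0) * x ^ i)
      atTop (𝓝 (expTail k x)) := by
    intro x
    have h1 : HasSum (fun i => (if k ≤ i then (i ! : ℝ)⁻¹ else 0) * x ^ i) (expTail k x) := by
      rw [← hasSum_nat_add_iff' k]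
      have h0 : ∑ i ∈ range k, (if k ≤ i then (i ! : ℝ)⁻¹ else 0) * x ^ i = 0 :=
        sum_eq_zero fun i hi => by simp [mem_range.1 hi]
      rw [h0, sub_zero]
      refine (hasSum_expTail k x).congr_fun fun i => ?_
      simp
      ring
    exact h1.tendsto_sum_nat
  exact le_of_tendsto_of_tendsto' ((h _).mul (h _)) ((h _).mul (h _)) fun n =>
    sum_mul_sum_le_of_le _ (fun i => by split_ifs <;> positivity) ha hab hs hst n

/-- The logarithmic derivative of `erlangCDF k`. -/
noncomputable def erlangHazard (k : ℕ) (x : ℝ) : ℝ := erlangPDF k x / erlangCDF k x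

lemma erlangHazard_pos (k : ℕ) {x : ℝ} (hx : 0 < x) : 0 < erlangHazard k x :=
  div_pos (erlangPDF_pos k hx) (erlangCDF_pos k hx)

lemma erlangHazard_eq (k : ℕ) (x : ℝ) :
    erlangHazard k x = x ^ k / k ! / expTail (k + 1) x := by
  rw [erlangHazard, erlangPDF, erlangCDF, mul_div_mul_left _ _ (Real.exp_pos _).ne']

/-- Dividing `expTail (k + 1) x` by `x ^ k` leaves a power series with nonnegative coefficients and
only positive powers, so the reciprocal of the hazard increases. The proof compares cross-multiplied
series term by term. -/
lemma strictAntiOn_erlangHazard (k : ℕ) : StrictAntiOn (erlangHazard k) (Set.Ioi 0) := by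
  intro x hx y hy hxy
  have hx' : 0 < x := hx
  have hy' : 0 < y := hy
  rw [erlangHazard_eq, erlangHazard_eq, div_lt_div_iff₀ (expTail_pos _ hy') (expTail_pos _ hx')]
  have h : ∀ i : ℕ, y ^ k / k ! * (x ^ (i + (k + 1)) / (i + (k + 1))!) <
      x ^ k / k ! * (y ^ (i + (k + 1)) / (i + (k + 1))!) := by
    intro i
    calc y ^ k / k ! * (x ^ (i + (k + 1)) / (i + (k + 1))!)
        = (x * y) ^ k / k ! / (i + (k + 1))! * x ^ (i + 1) := by ring
      _ < (x * y) ^ k / k ! / (i + (k + 1))! * y ^ (i + 1) := by gcongr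
      _ = _ := by ring
  exact hasSum_lt (fun i => (h i).le) (h 0) ((hasSum_expTail (k + 1) x).mul_left _)
    ((hasSum_expTail (k + 1) y).mul_left _)

/-- The numerators of the two products coincide, so total positivity of `expTail` in the
denominators decides, with the inequality reversed. -/
lemma erlangHazard_mul_le (k : ℕ) {a b s t : ℝ} (ha : 0 < a) (hab : a ≤ b) (hs : 0 < s)
    (hst : s ≤ t) :
    erlangHazard k (a * s) * erlangHazard k (b * t) ≤
      erlangHazard k (a * t) * erlangHazard k (b * s) := by
  have hb := ha.trans_le hab
  have ht := hs.trans_le hst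
  simp only [erlangHazard_eq, div_mul_div_comm]
  have hnum : (a * s) ^ k * (b * t) ^ k = (a * t) ^ k * (b * s) ^ k := by ring
  rw [hnum]
  have h1 := expTail_pos (k + 1) (mul_pos ha ht)
  have h2 := expTail_pos (k + 1) (mul_pos hb hs)
  exact div_le_div_of_nonneg_left (by positivity) (mul_pos h1 h2)
    (expTail_mul_expTail_le (k + 1) ha.le hab hs.le hst)

lemma maxSlope_eq {N : ℕ} (k : ℕ) {p : Fin N → ℝ} (hp : ∀ i, 0 < p i) (q : Fin N → ℝ) {t : ℝ}
    (ht : 0 < t) : maxSlope k p q t = maxCDF k p t * ∑ j, q j * erlangHazard k (p j * t) := by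
  rw [maxSlope, mul_sum]
  refine sum_congr rfl fun j _ => ?_
  rw [maxCDF, ← mul_prod_erase _ _ (mem_univ j), erlangHazard]
  have := (erlangCDF_pos k (mul_pos (hp j) ht)).ne'
  field_simp

lemma maxCDF_pos {N : ℕ} (k : ℕ) {p : Fin N → ℝ} (hp : ∀ i, 0 < p i) {t : ℝ} (ht : 0 < t) :
    0 < maxCDF k p t :=
  prod_pos fun j _ => erlangCDF_pos k (mul_pos (hp j) ht)

/-- This is monotonicity in time of ∑ h(p_j t) / ∑ p_j h(p_j t). Symmetrizing the double sum gives
`p j - p i` times a hazard minor of the same sign. -/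
lemma sum_erlangHazard_mul_le {N : ℕ} (k : ℕ) {p : Fin N → ℝ} (hp : ∀ i, 0 < p i) {s t : ℝ}
    (hs : 0 < s) (hst : s ≤ t) :
    (∑ j, erlangHazard k (p j * s)) * ∑ j, p j * erlangHazard k (p j * t) ≤
      (∑ j, erlangHazard k (p j * t)) * ∑ j, p j * erlangHazard k (p j * s) := by
  rw [← sub_nonneg]
  simp only [sum_mul_sum, ← sum_sub_distrib]
  refine sum_sum_nonneg_of_add_swap_nonneg _ _ fun i _ j _ => ?_
  rcases le_total (p i) (p j) with h | h
  · nlinarith [mul_nonneg (sub_nonneg.2 h)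
      (sub_nonneg.2 (erlangHazard_mul_le k (hp i) h hs hst))]
  · nlinarith [mul_nonneg (sub_nonneg.2 h)
      (sub_nonneg.2 (erlangHazard_mul_le k (hp j) h hs hst))]

/-! ### Monotonicity of the variance -/

lemma sum_uniformVec {N : ℕ} (hN : N ≠ 0) : ∑ i, uniformVec N i = 1 := by
  have : (N : ℝ) ≠ 0 := by exact_mod_cast hN
  simp [uniformVec, this]

lemma maxSlope_uniformVec_sub_pos {N : ℕ} (k : ℕ) {p : Fin N → ℝ} (hN : N ≠ 0)
    (hp : ∀ i, 0 < p i) (hs : ∑ i, p i = 1) (hne : p ≠ uniformVec N) {t : ℝ} (ht : 0 < t) :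
    0 < maxSlope k p (uniformVec N - p) t := by
  have hN' : (0 : ℝ) < N := by exact_mod_cast Nat.pos_of_ne_zero hN
  rw [maxSlope_eq k hp _ ht]
  refine mul_pos (maxCDF_pos k hp ht) ?_
  -- The direction sums to zero, so the hazard at the uniform rate can be subtracted for free,
  -- making every summand a product of factors of equal sign.
  have h0 : ∑ j, (uniformVec N - p) j * erlangHazard k (1 / N * t) = 0 := by
    rw [← sum_mul]
    simp only [Pi.sub_apply, sum_sub_distrib, hs, sum_uniformVec hN]
    simp
  have h1 : ∑ j, (uniformVec N - p) j * erlangHazard k (p j * t) =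
      ∑ j, ((uniformVec N - p) j * erlangHazard k (p j * t) -
        (uniformVec N - p) j * erlangHazard k (1 / N * t)) := by
    rw [sum_sub_distrib, h0, sub_zero]
  rw [h1]
  have hu : 1 / N * t ∈ Set.Ioi (0 : ℝ) := Set.mem_Ioi.2 (by positivity)
  have hpt : ∀ j, p j * t ∈ Set.Ioi (0 : ℝ) := fun j => mul_pos (hp j) ht
  have hpos : ∀ j, p j ≠ 1 / N → 0 < (uniformVec N - p) j * erlangHazard k (p j * t) -
      (uniformVec N - p) j * erlangHazard k (1 / N * t) := by
    intro j hj
    rw [← mul_sub, Pi.sub_apply, uniformVec]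
    rcases lt_or_gt_of_ne hj with h | h
    · exact mul_pos (sub_pos.2 h) (sub_pos.2
        (strictAntiOn_erlangHazard k (hpt j) hu (mul_lt_mul_of_pos_right h ht)))
    · exact mul_pos_of_neg_of_neg (sub_neg.2 h) (sub_neg.2
        (strictAntiOn_erlangHazard k hu (hpt j) (mul_lt_mul_of_pos_right h ht)))
  obtain ⟨j, hj⟩ := Function.ne_iff.1 hne
  refine sum_pos' (fun i _ => ?_) ⟨j, mem_univ j, ?_⟩
  by_cases hi : p i = 1 / N
  · simp [uniformVec, hi]
  · exact (hpos i hi).le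
  · exact hpos j hj

lemma setIntegral_Ioi_pos {f : ℝ → ℝ} (hint : IntegrableOn f (Set.Ioi 0))
    (hf : ∀ t, 0 < t → 0 < f t) : 0 < ∫ t in Set.Ioi (0 : ℝ), f t := by
  rw [setIntegral_pos_iff_support_of_nonneg_ae _ hint]
  · have : Function.support f ∩ Set.Ioi 0 = Set.Ioi 0 :=
      Set.inter_eq_right.2 fun t ht => (hf t ht).ne'
    rw [this, Real.volume_Ioi]
    exact ENNReal.zero_lt_top
  · filter_upwards [ae_restrict_mem measurableSet_Ioi] with t ht
    exact (hf t ht).le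

/-- A Chebyshev correlation inequality: the direction `uniformVec N` weights late times more than
the direction `p` does. -/
lemma mul_integral_maxSlope_le {N : ℕ} (k : ℕ) {p : Fin N → ℝ} (hN : N ≠ 0)
    (hp : ∀ i, 0 < p i) {c : ℝ} (hc : 0 < c)
    (hmean : ∫ t in Set.Ioi (0 : ℝ), t ^ 2 * maxSlope k p p t =
      c * ∫ t in Set.Ioi (0 : ℝ), t ^ 1 * maxSlope k p p t) :
    c * ∫ t in Set.Ioi (0 : ℝ), t ^ 1 * maxSlope k p (uniformVec N - p) t ≤
      ∫ t in Set.Ioi (0 : ℝ), t ^ 2 * maxSlope k p (uniformVec N - p) t := by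
  have : NeZero N := ⟨hN⟩
  set A : ℝ → ℝ := fun t => ∑ j, erlangHazard k (p j * t)
  set B : ℝ → ℝ := fun t => ∑ j, p j * erlangHazard k (p j * t)
  have hA : ∀ t, 0 < t → ∑ j, uniformVec N j * erlangHazard k (p j * t) = 1 / N * A t :=
    fun t _ => by simp only [uniformVec, A, mul_sum]
  have hB : ∀ t, 0 < t → 0 < B t := fun t ht =>
    sum_pos (fun j _ => mul_pos (hp j) (erlangHazard_pos k (mul_pos (hp j) ht))) univ_nonempty
  -- `ρ` is the monotone ratio at `t = c`, so `1 / N * A t - ρ * B t` has the sign of `t - c`.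
  set ρ : ℝ := 1 / N * A c / B c
  have hρ : ρ * B c = 1 / N * A c := div_mul_cancel₀ _ (hB c hc).ne'
  have hmono : ∀ t, 0 < t → 0 ≤ (t - c) * (1 / N * A t - ρ * B t) := by
    intro t ht
    have hN' : (0 : ℝ) ≤ 1 / N := by positivity
    have key : (1 / N * A t - ρ * B t) * B c = 1 / N * (A t * B c - A c * B t) := by
      linear_combination -(B t) * hρ
    rcases le_total c t with h | h
    · refine mul_nonneg (sub_nonneg.2 h) (nonneg_of_mul_nonneg_left ?_ (hB c hc))
      rw [key]
      exact mul_nonneg hN' (sub_nonneg.2 (sum_erlangHazard_mul_le k hp hc h))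
    · refine mul_nonneg_of_nonpos_of_nonpos (sub_nonpos.2 h)
        (nonpos_of_mul_nonpos_left ?_ (hB c hc))
      rw [key]
      exact mul_nonpos_of_nonneg_of_nonpos hN' (sub_nonpos.2 (sum_erlangHazard_mul_le k hp ht h))
  -- The integrand is `(t - c) * (1 / N * A t - ρ * B t)` times the nonnegative factor `t * maxCDF k
  -- p t`. By `hmean` the part carrying `ρ - 1` integrates to zero.
  have hnn : 0 ≤ ∫ t in Set.Ioi (0 : ℝ),
      ((t ^ 2 * maxSlope k p (uniformVec N - p) t - c * (t ^ 1 * maxSlope k p (uniformVec N - p) t))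
        - (ρ - 1) * (t ^ 2 * maxSlope k p p t - c * (t ^ 1 * maxSlope k p p t))) := by
    refine setIntegral_nonneg measurableSet_Ioi fun t ht => ?_
    have ht' : 0 < t := ht
    rw [maxSlope_sub, maxSlope_eq k hp _ ht', maxSlope_eq k hp p ht', hA t ht']
    have := mul_nonneg (mul_nonneg ht'.le (maxCDF_pos k hp ht').le) (hmono t ht')
    refine this.trans_eq ?_
    simp only [B]
    ring
  have h1 := fun n q => integrableOn_pow_mul_maxSlope n k hp q
  have h2 : ∀ q, IntegrableOn
      (fun t => t ^ 2 * maxSlope k p q t - c * (t ^ 1 * maxSlope k p q t)) (Set.Ioi 0) :=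
    fun q => (h1 2 q).sub ((h1 1 q).const_mul c)
  rw [integral_sub (h2 _) ((h2 _).const_mul _), integral_const_mul,
    integral_sub (h1 _ _) ((h1 _ _).const_mul c), integral_sub (h1 _ _) ((h1 _ _).const_mul c),
    integral_const_mul, integral_const_mul, hmean, sub_self, mul_zero, sub_zero] at hnn
  exact sub_nonneg.1 hnn

/-- The derivative of the variance towards the uniform vector is negative. -/
lemma derivative_timeVariance_pos {N : ℕ} (k : ℕ) {p : Fin N → ℝ} (hN : N ≠ 0)
    (hp : ∀ i, 0 < p i) (hs : ∑ i, p i = 1) (hne : p ≠ uniformVec N) :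
    0 < 2 * (∫ t in Set.Ioi (0 : ℝ), t ^ 2 * maxSlope k p (uniformVec N - p) t) -
      (1 + 2 * tailMoment 0 k p) *
        ∫ t in Set.Ioi (0 : ℝ), t ^ 1 * maxSlope k p (uniformVec N - p) t := by
  have : NeZero N := ⟨hN⟩
  have hD : 0 < ∫ t in Set.Ioi (0 : ℝ), t ^ 1 * maxSlope k p (uniformVec N - p) t :=
    setIntegral_Ioi_pos (integrableOn_pow_mul_maxSlope 1 k hp _) fun t ht =>
      mul_pos (pow_pos ht 1) (maxSlope_uniformVec_sub_pos k hN hp hs hne ht)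
  have h0 : ∫ t in Set.Ioi (0 : ℝ), t ^ 1 * maxSlope k p p t = tailMoment 0 k p := by
    simpa using integral_pow_succ_mul_maxSlope 0 k hp
  have h1 : ∫ t in Set.Ioi (0 : ℝ), t ^ 2 * maxSlope k p p t = 2 * tailMoment 1 k p := by
    rw [integral_pow_succ_mul_maxSlope 1 k hp]
    norm_num
  have hE : 0 < tailMoment 0 k p := by
    rw [← h0]
    refine setIntegral_Ioi_pos (integrableOn_pow_mul_maxSlope 1 k hp _) fun t ht =>
      mul_pos (pow_pos ht 1) ?_
    rw [maxSlope_eq k hp p ht]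
    exact mul_pos (maxCDF_pos k hp ht) (sum_pos
      (fun j _ => mul_pos (hp j) (erlangHazard_pos k (mul_pos (hp j) ht))) univ_nonempty)
  -- Nonnegativity of the discrete variance is stronger than that of Var X by the term E X, and this
  -- yields `1 + tailMoment 0 k p` in `hc`.
  have hvar : 0 ≤ 2 * tailMoment 1 k p - tailMoment 0 k p - tailMoment 0 k p ^ 2 := by
    rw [← timeVariance_eq k hp hs]
    exact variance_nonneg _ _
  have hc : 1 + tailMoment 0 k p ≤ 2 * tailMoment 1 k p / tailMoment 0 k p := by
    rw [le_div_iff₀ hE]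
    linarith
  have hch := mul_integral_maxSlope_le k hN hp
    (c := 2 * tailMoment 1 k p / tailMoment 0 k p) (by linarith)
    (by rw [h0, h1, div_mul_cancel₀ _ hE.ne'])
  have := mul_le_mul_of_nonneg_right hc hD.le
  linarith

lemma sum_ray {N : ℕ} (hN : N ≠ 0) {p : Fin N → ℝ} (hs : ∑ i, p i = 1) (θ : ℝ) :
    ∑ i, ray p θ i = 1 := by
  simp only [ray, Pi.add_apply, Pi.smul_apply, Pi.sub_apply, smul_eq_mul, sum_add_distrib,
    ← mul_sum, sum_sub_distrib, hs, sum_uniformVec hN]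
  ring

lemma ray_zero {N : ℕ} (p : Fin N → ℝ) : ray p 0 = uniformVec N := by simp [ray]

lemma ray_one {N : ℕ} (p : Fin N → ℝ) : ray p 1 = p := by simp [ray]

lemma continuous_ray {N : ℕ} (p : Fin N → ℝ) (i : Fin N) : Continuous fun θ => ray p θ i := by
  simp only [ray, Pi.add_apply, Pi.smul_apply, smul_eq_mul]
  fun_prop

lemma convex_setOf_ray_pos {N : ℕ} (p : Fin N → ℝ) :
    Convex ℝ {θ : ℝ | 0 ≤ θ ∧ ∀ i, 0 < ray p θ i} := by
  intro x hx y hy a b ha hb hab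
  refine ⟨convex_Ici (0 : ℝ) hx.1 hy.1 ha hb hab, fun i => ?_⟩
  have h : ray p (a • x + b • y) i = a • ray p x i + b • ray p y i := by
    simp only [ray, Pi.add_apply, Pi.smul_apply, smul_eq_mul]
    linear_combination -(uniformVec N i) * hab
  rw [h]
  exact convex_Ioi (0 : ℝ) (hx.2 i) (hy.2 i) ha hb hab

lemma hasDerivAt_timeVariance_ray {N : ℕ} (k : ℕ) {p : Fin N → ℝ} (hN : N ≠ 0)
    (hs : ∑ i, p i = 1) {θ : ℝ} (hp : ∀ i, 0 < ray p θ i) :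
    HasDerivAt (fun θ => timeVariance (k + 1) (ray p θ))
      ((1 + 2 * tailMoment 0 k (ray p θ)) *
          (∫ t in Set.Ioi (0 : ℝ), t ^ 1 * maxSlope k (ray p θ) (p - uniformVec N) t) -
        2 * ∫ t in Set.Ioi (0 : ℝ), t ^ 2 * maxSlope k (ray p θ) (p - uniformVec N) t) θ := by
  have h0 := hasDerivAt_tailMoment_line 0 k (uniformVec N) (p - uniformVec N) hp
  have h1 := hasDerivAt_tailMoment_line 1 k (uniformVec N) (p - uniformVec N) hp
  have h := ((h1.const_mul 2).fun_sub h0).fun_sub (h0.fun_pow 2)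
  have hev : (fun θ => timeVariance (k + 1) (ray p θ)) =ᶠ[𝓝 θ] fun θ =>
      2 * tailMoment 1 k (ray p θ) - tailMoment 0 k (ray p θ) - tailMoment 0 k (ray p θ) ^ 2 := by
    filter_upwards [eventually_all.2 fun i =>
      (continuous_ray p i).continuousAt.eventually_const_lt (hp i)] with x hx
    exact timeVariance_eq k hx (sum_ray hN hs x)
  refine (h.congr_of_eventuallyEq hev).congr_deriv ?_
  simp only [ray]
  norm_num
  ring

lemma strictMonoOn_timeVariance_ray {N : ℕ} (k : ℕ) {p : Fin N → ℝ} (hN : N ≠ 0)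
    (hs : ∑ i, p i = 1) (hne : p ≠ uniformVec N) :
    StrictMonoOn (fun θ : ℝ => timeVariance (k + 1) (ray p θ))
      {θ : ℝ | 0 ≤ θ ∧ ∀ i, 0 < ray p θ i} := by
  refine strictMonoOn_of_deriv_pos (convex_setOf_ray_pos p)
    (fun θ hθ => (hasDerivAt_timeVariance_ray k hN hs hθ.2).continuousAt.continuousWithinAt) ?_
  intro θ hθ
  -- Only interior points are tested; at `θ = 0` the vector is uniform and the derivative vanishes.
  have hθ0 : 0 < θ := by
    have := interior_mono (t := Set.Ici (0 : ℝ)) (fun x hx => hx.1) hθ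
    rwa [interior_Ici] at this
  have hpos := (interior_subset hθ).2
  have hne' : ray p θ ≠ uniformVec N := by
    intro h
    refine hne (sub_eq_zero.1 ?_)
    have h' : θ • (p - uniformVec N) = 0 := by simpa [ray] using h
    exact (smul_eq_zero.1 h').resolve_left hθ0.ne'
  -- Moving out along the ray is a negative multiple of moving from the current point to the uniform
  -- vector, the direction whose sign is known.
  have hdir : p - uniformVec N = (-θ⁻¹) • (uniformVec N - ray p θ) := by
    rw [ray, sub_add_cancel_left, smul_neg, neg_smul, neg_neg, smul_smul,
      inv_mul_cancel₀ hθ0.ne', one_smul]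
  have hint : ∀ n, ∫ t in Set.Ioi (0 : ℝ), t ^ n * maxSlope k (ray p θ) (p - uniformVec N) t =
      -θ⁻¹ * ∫ t in Set.Ioi (0 : ℝ),
        t ^ n * maxSlope k (ray p θ) (uniformVec N - ray p θ) t := by
    intro n
    rw [← integral_const_mul]
    refine integral_congr_ae (Eventually.of_forall fun t => ?_)
    beta_reduce
    rw [hdir, maxSlope_smul]
    ring
  rw [(hasDerivAt_timeVariance_ray k hN hs hpos).deriv, hint, hint]
  have := mul_pos (inv_pos.2 hθ0)
    (derivative_timeVariance_pos k hN hpos (sum_ray hN hs θ) hne')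
  linarith

end DixieCup

theorem mainTheorem1 (m N : ℕ) (hm : 1 ≤ m) (hN : 2 ≤ N) (p : Fin N → ℝ)
    (hpos : ∀ i, 0 < p i) (hsum : ∑ i, p i = 1) :
    -- the completion time is almost surely finite and square integrable
    (∀ᵐ ω ∂(DixieCup.drawsLaw p), DixieCup.completionTime m ω ≠ ⊤) ∧
    MemLp (DixieCup.realTime m) 2 (DixieCup.drawsLaw p) ∧
    -- its variance is minimal at the uniform vector, and only there
    DixieCup.timeVariance m (DixieCup.uniformVec N) ≤ DixieCup.timeVariance m p ∧
    (DixieCup.timeVariance m p = DixieCup.timeVariance m (DixieCup.uniformVec N) ↔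
      p = DixieCup.uniformVec N) ∧
    -- it strictly increases along the part of the ray that consists of positive vectors
    (p ≠ DixieCup.uniformVec N →
      StrictMonoOn (fun θ : ℝ => DixieCup.timeVariance m (DixieCup.ray p θ))
        {θ : ℝ | 0 ≤ θ ∧ ∀ i, 0 < DixieCup.ray p θ i}) := by
  -- `erlangCDF k` belongs to point `k + 1`, so `m` is written as `k + 1`.
  obtain ⟨k, rfl⟩ := Nat.exists_eq_add_of_le' hm
  have hN0 : N ≠ 0 := by omega
  have hmono := DixieCup.strictMonoOn_timeVariance_ray (p := p) k hN0 hsum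
  have hlt : p ≠ DixieCup.uniformVec N →
      DixieCup.timeVariance (k + 1) (DixieCup.uniformVec N) <
        DixieCup.timeVariance (k + 1) p := by
    intro hne
    have hN' : (0 : ℝ) < N := by exact_mod_cast Nat.pos_of_ne_zero hN0
    have h := hmono hne (a := 0) (b := 1)
      ⟨le_rfl, fun i => by rw [DixieCup.ray_zero]; exact one_div_pos.2 hN'⟩
      ⟨zero_le_one, fun i => by rw [DixieCup.ray_one]; exact hpos i⟩ one_pos
    simpa only [DixieCup.ray_zero, DixieCup.ray_one] using h
  refine ⟨DixieCup.ae_completionTime_ne_top k hpos hsum, DixieCup.memLp_realTime k hpos hsum,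
    ?_, ⟨fun h => ?_, fun h => by rw [h]⟩, hmono⟩
  · by_cases hne : p = DixieCup.uniformVec N
    · rw [← hne]
    · exact (hlt hne).le
  · by_contra hne
    exact (hlt hne).ne' h
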